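/- Let $\gamma^0,\gamma^1,\gamma^2,\gamma^3$ be the gamma matrices in the Dirac representation, $$\gamma^0=\begin{pmatrix}I&0\\0&-I\end{pmatrix},\qquad \gamma^a=\begin{pmatrix}0&\sigma^a\\-\sigma^a&0\end{pmatrix}\quad(a=1,2,3),$$ with $\sigma^a$ the Pauli matrices, and put $\gamma^5=i\gamma^0\gamma^1\gamma^2\gamma^3$, $C=i\gamma^1\gamma^3$, $C^5=C\gamma^5$. Let $\Psi_{jklm}$ ($j,k,l,m\in\{0,1,2,3\}$) be the $256$ coefficients of a state of four Dirac spinors, regarded as independent variables; all polynomials below are polynomials over $\mathbb{C}$ in these variables, and repeated indices are summed over $\{0,1,2,3\}$. For $X^1,X^2,X^3,X^4\in\{C,C^5\}$ let $$H(X^1,X^2,X^3,X^4)=X^1_{nj}X^2_{pk}X^3_{ql}X^4_{rm}\,\Psi_{jklm}\Psi_{npqr}.$$ These are the $16$ polynomials $H_a,\dots,H_p$ of degree $2$; in particular $H_a=H(C,C,C,C)$ and $H_b=H(C^5,C^5,C^5,C^5)$. For $X\in\{C,C^5\}$ put $$W(X;P)=X_{nj}X_{pk}X_{ql}X_{rm}X_{uw}X_{vx}X_{sy}X_{tz}\,P,$$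 where $P$ is a product of four coefficients $\Psi$ carrying the sixteen indices. Let $P_a,\dots,P_m$ be $$\begin{aligned} P_a&=\Psi_{jklm}\Psi_{uvqr}\Psi_{npyz}\Psi_{wxst}, & P_b&=\Psi_{jklm}\Psi_{uvqr}\Psi_{nxyz}\Psi_{wpst},\\ P_c&=\Psi_{jklm}\Psi_{nvqz}\Psi_{upsr}\Psi_{wxyt}, & P_d&=\Psi_{jklm}\Psi_{nvqz}\Psi_{wxsr}\Psi_{upyt},\\ P_e&=\Psi_{jklm}\Psi_{npst}\Psi_{uvqz}\Psi_{wxyr}, & P_f&=\Psi_{jklm}\Psi_{upqt}\Psi_{nvsr}\Psi_{wxyz},\\ P_g&=\Psi_{jklm}\Psi_{upqt}\Psi_{nvsz}\Psi_{wxyr}, & P_h&=\Psi_{jklm}\Psi_{upsr}\Psi_{nvyt}\Psi_{wxqz},\\ P_i&=\Psi_{jklm}\Psi_{nvsr}\Psi_{upyt}\Psi_{wxqz}, & P_j&=\Psi_{jklm}\Psi_{nvqr}\Psi_{uxyt}\Psi_{wpsz},\\ P_k&=\Psi_{jklm}\Psi_{upqr}\Psi_{nvst}\Psi_{wxyz},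 & P_l&=\Psi_{jklm}\Psi_{npsr}\Psi_{uvyz}\Psi_{wxqt},\\ P_m&=\Psi_{jklm}\Psi_{npqt}\Psi_{uvsr}\Psi_{wxyz}, && \end{aligned}$$ and set $T_\ast=W(C;P_\ast)$ and $Y_\ast=W(C^5;P_\ast)$ for $\ast=a,\dots,m$. Then the $26$ polynomials $T_a,\dots,T_m,Y_a,\dots,Y_m$ of degree $4$ and the $16$ squares $H_a^2,\dots,H_p^2$ together span a complex vector space of dimension $41$. They satisfy $$\begin{aligned}H_b^2-H_a^2=2(&T_a-T_b-T_c-T_d-T_e+T_f-T_g-T_h-T_i-T_j-T_k-T_l-T_m\\&-Y_a+Y_b+Y_c+Y_d+Y_e-Y_f+Y_g+Y_h+Y_i+Y_j+Y_k+Y_l+Y_m),\end{aligned}$$ and this is the only linear relation among the $42$ polynomials up to a scalar factor: every family of complex coefficients whose linear combination of the $42$ polynomials vanishes is a multiple of the coefficient family of this relation. -/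

import Mathlib

noncomputable section

namespace FourSpinors

/-- The gamma matrices in the Dirac representation. -/
def gamma0 : Matrix (Fin 4) (Fin 4) ℂ :=
  !![1, 0, 0, 0; 0, 1, 0, 0; 0, 0, -1, 0; 0, 0, 0, -1]

def gamma1 : Matrix (Fin 4) (Fin 4) ℂ :=
  !![0, 0, 0, 1; 0, 0, 1, 0; 0, -1, 0, 0; -1, 0, 0, 0]

def gamma2 : Matrix (Fin 4) (Fin 4) ℂ :=
  !![0, 0, 0, -Complex.I; 0, 0, Complex.I, 0; 0, Complex.I, 0, 0; -Complex.I, 0, 0, 0]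

def gamma3 : Matrix (Fin 4) (Fin 4) ℂ :=
  !![0, 0, 1, 0; 0, 0, 0, -1; -1, 0, 0, 0; 0, 1, 0, 0]

def gamma5 : Matrix (Fin 4) (Fin 4) ℂ :=
  Complex.I • (gamma0 * gamma1 * gamma2 * gamma3)

/-- The matrix `C = i γ¹ γ³`. -/
def chargeC : Matrix (Fin 4) (Fin 4) ℂ :=
  Complex.I • (gamma1 * gamma3)

/-- The matrix `C⁵ = C γ⁵`. -/
def chargeC5 : Matrix (Fin 4) (Fin 4) ℂ :=
  chargeC * gamma5

/-- Complex polynomials in the 256 state coefficients of four Dirac spinors. -/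
abbrev StatePoly : Type := MvPolynomial (Fin 4 × Fin 4 × Fin 4 × Fin 4) ℂ

/-- The state coefficient `Ψ_{jklm}`, an indeterminate. -/
def Ψ (j k l m : Fin 4) : StatePoly := MvPolynomial.X (j, k, l, m)

/-- The degree 2 contraction, with one matrix for each of the four particles. -/
def quadraticContraction (X₁ X₂ X₃ X₄ : Matrix (Fin 4) (Fin 4) ℂ) : StatePoly :=
  ∑ j : Fin 4, ∑ k : Fin 4, ∑ l : Fin 4, ∑ m : Fin 4,
  ∑ n : Fin 4, ∑ p : Fin 4, ∑ q : Fin 4, ∑ r : Fin 4,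
    MvPolynomial.C (X₁ n j * X₂ p k * X₃ q l * X₄ r m) * (Ψ j k l m * Ψ n p q r)

/-- The polynomials `H_a, …, H_p`, in this order. -/
def H : Fin 16 → StatePoly :=
  ![quadraticContraction chargeC chargeC chargeC chargeC,
    quadraticContraction chargeC5 chargeC5 chargeC5 chargeC5,
    quadraticContraction chargeC chargeC chargeC chargeC5,
    quadraticContraction chargeC chargeC chargeC5 chargeC,
    quadraticContraction chargeC5 chargeC chargeC chargeC,
    quadraticContraction chargeC chargeC5 chargeC chargeC,
    quadraticContraction chargeC chargeC chargeC5 chargeC5,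
    quadraticContraction chargeC5 chargeC chargeC chargeC5,
    quadraticContraction chargeC chargeC5 chargeC chargeC5,
    quadraticContraction chargeC5 chargeC chargeC5 chargeC,
    quadraticContraction chargeC chargeC5 chargeC5 chargeC,
    quadraticContraction chargeC5 chargeC5 chargeC chargeC,
    quadraticContraction chargeC5 chargeC5 chargeC5 chargeC,
    quadraticContraction chargeC5 chargeC5 chargeC chargeC5,
    quadraticContraction chargeC chargeC5 chargeC5 chargeC5,
    quadraticContraction chargeC5 chargeC chargeC5 chargeC5]

/-- The thirteen ways, labelled `a, …, m` in this order, to distribute the sixteen indices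
over four copies of `Ψ`. -/
def indexPattern (a : Fin 13) (j k l m n p q r s t u v w x y z : Fin 4) : StatePoly :=
  match a with
  | 0 => Ψ j k l m * Ψ u v q r * Ψ n p y z * Ψ w x s t
  | 1 => Ψ j k l m * Ψ u v q r * Ψ n x y z * Ψ w p s t
  | 2 => Ψ j k l m * Ψ n v q z * Ψ u p s r * Ψ w x y t
  | 3 => Ψ j k l m * Ψ n v q z * Ψ w x s r * Ψ u p y t
  | 4 => Ψ j k l m * Ψ n p s t * Ψ u v q z * Ψ w x y r
  | 5 => Ψ j k l m * Ψ u p q t * Ψ n v s r * Ψ w x y z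
  | 6 => Ψ j k l m * Ψ u p q t * Ψ n v s z * Ψ w x y r
  | 7 => Ψ j k l m * Ψ u p s r * Ψ n v y t * Ψ w x q z
  | 8 => Ψ j k l m * Ψ n v s r * Ψ u p y t * Ψ w x q z
  | 9 => Ψ j k l m * Ψ n v q r * Ψ u x y t * Ψ w p s z
  | 10 => Ψ j k l m * Ψ u p q r * Ψ n v s t * Ψ w x y z
  | 11 => Ψ j k l m * Ψ n p s r * Ψ u v y z * Ψ w x q t
  | 12 => Ψ j k l m * Ψ n p q t * Ψ u v s r * Ψ w x y z

/-- The degree 4 contraction with the same matrix `X` used for all eight index pairs. -/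
def quarticContraction (X : Matrix (Fin 4) (Fin 4) ℂ) (a : Fin 13) : StatePoly :=
  ∑ j : Fin 4, ∑ k : Fin 4, ∑ l : Fin 4, ∑ m : Fin 4,
  ∑ n : Fin 4, ∑ p : Fin 4, ∑ q : Fin 4, ∑ r : Fin 4,
  ∑ s : Fin 4, ∑ t : Fin 4, ∑ u : Fin 4, ∑ v : Fin 4,
  ∑ w : Fin 4, ∑ x : Fin 4, ∑ y : Fin 4, ∑ z : Fin 4,
    MvPolynomial.C (X n j * X p k * X q l * X r m * (X u w * X v x * X s y * X t z)) *
      indexPattern a j k l m n p q r s t u v w x y z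

/-- The polynomials `T_a, …, T_m`, in this order. -/
def T (a : Fin 13) : StatePoly := quarticContraction chargeC a

/-- The polynomials `Y_a, …, Y_m`, in this order. -/
def Y (a : Fin 13) : StatePoly := quarticContraction chargeC5 a

end FourSpinors

end

open FourSpinors

/-! Each of the 42 polynomials contracts four copies of Ψ: for every particle the four copies are
paired off in one of three ways and each pair is contracted with `C` or `C⁵`. Both matrices are i
times an antisymmetric integer matrix E, and the powers i⁴ and i⁸ that arise equal 1. A square `H i
^ 2` uses the same pairing for all four particles; T and Y use non-constant choices. The relation
comes from the Pfaffian. The signed sum of the three pairings of E is Pf(E) times the Levi-Civita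
tensor, and the Pfaffians for `C` and `C⁵` are 1 and -1. With four particles the sign disappears, so
the sum over all 81 choices of pairings is the same for both matrices
(`sum_pairContraction_charge`). Renaming copies permutes the three pairings simultaneously for all
particles; the 81 choices form 13 free orbits, represented by the patterns a, …, m, and one orbit of
3 constant choices (`sum_pairContraction`). Dividing by 3 gives the identity. For uniqueness,
coefficients are compared at monomials with four distinct factors (`coeff_contraction`). Fourteen
monomials each occur in a single square and kill its coefficient. Twenty-seven others each occur in
exactly two polynomials and form a tree joining `H 0 ^ 2`, all T and all Y to `H 1 ^ 2`. So the
kernel is a line and the rank is 42 - 1. -/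

noncomputable section

namespace FourSpinors

open MvPolynomial

/-! ### Charge matrices and contractions of four copies of Ψ -/

/-- The integer matrices `E` with `C = i E` (for `false`) and `C⁵ = i E` (for `true`). -/
def charge : Bool → Fin 4 → Fin 4 → ℤ
  | false => ![![0, 1, 0, 0], ![-1, 0, 0, 0], ![0, 0, 0, 1], ![0, 0, -1, 0]]
  | true => ![![0, 0, 0, 1], ![0, 0, -1, 0], ![0, 1, 0, 0], ![-1, 0, 0, 0]]

/-- The complex matrix `C` (for `false`) or `C⁵` (for `true`). -/
def chargeMatrix : Bool → Matrix (Fin 4) (Fin 4) ℂ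
  | false => chargeC
  | true => chargeC5

theorem charge_antisymm (b : Bool) (p q : Fin 4) : charge b p q = -charge b q p := by
  revert b p q; decide

theorem chargeMatrix_apply (b : Bool) (p q : Fin 4) :
    chargeMatrix b p q = Complex.I * (charge b p q : ℂ) := by
  have hC (i j : Fin 4) : chargeC i j = Complex.I * (charge false i j : ℂ) := by
    unfold chargeC
    fin_cases i <;> fin_cases j <;>
      simp [gamma1, gamma3, charge]
  have h5 : gamma5 = !![0, 0, 1, 0; 0, 0, 0, 1; 1, 0, 0, 0; 0, 1, 0, 0] := by
    unfold gamma5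
    ext i j
    fin_cases i <;> fin_cases j <;>
      simp [gamma0, gamma1, gamma2, gamma3]
  cases b
  · exact hC p q
  · rw [chargeMatrix, chargeC5, h5, Matrix.mul_apply, Fin.sum_univ_four]
    simp only [hC]
    fin_cases p <;> fin_cases q <;> simp [charge]

/-- The indices of four copies of `Ψ`: the index of copy `c` for particle `i` is `h c i`. -/
abbrev Config : Type := Fin 4 → Fin 4 → Fin 4

/-- The state coefficient with its four indices given as a function. -/
def stateVar (g : Fin 4 → Fin 4) : StatePoly := Ψ (g 0) (g 1) (g 2) (g 3)

/-- The contraction of four copies of `Ψ` with a tensor `A i` for each particle `i`. -/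
def contraction (A : Fin 4 → (Fin 4 → Fin 4) → ℤ) : StatePoly :=
  ∑ h : Config, C ((∏ i, A i (fun c => h c i) : ℤ) : ℂ) * ∏ c, stateVar (h c)

/-- The three ways to contract four indices pairwise with `E`, with the signs that make them
change by the sign of a permutation of the indices. -/
def pairTensor (E : Fin 4 → Fin 4 → ℤ) (a : Fin 3) (g : Fin 4 → Fin 4) : ℤ :=
  match a with
  | 0 => E (g 0) (g 1) * E (g 2) (g 3)
  | 1 => -(E (g 0) (g 2) * E (g 1) (g 3))
  | 2 => E (g 0) (g 3) * E (g 1) (g 2)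

theorem contraction_comp_perm (A : Fin 4 → (Fin 4 → Fin 4) → ℤ) (σ : Equiv.Perm (Fin 4)) :
    contraction (fun i g => A i (g ∘ σ)) = contraction A := by
  unfold contraction
  rw [← (Equiv.arrowCongr σ (Equiv.refl (Fin 4 → Fin 4))).sum_comp]
  refine Finset.sum_congr rfl fun h _ => ?_
  rw [← Equiv.prod_comp σ.symm (fun c => stateVar (h c))]
  refine congrArg₂ _ ?_ ?_
  · simp [Function.comp_def, Equiv.arrowCongr]
  · simp [Equiv.arrowCongr]

/-- Multilinearity in the four tensors: expanding the product over particles selects one summand for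
each particle. -/
theorem contraction_sum (t : Fin 4 → Fin 3 → (Fin 4 → Fin 4) → ℤ) :
    contraction (fun i g => ∑ a, t i a g) =
      ∑ π : Fin 4 → Fin 3, contraction (fun i => t i (π i)) := by
  unfold contraction
  rw [Finset.sum_comm]
  refine Finset.sum_congr rfl fun h _ => ?_
  rw [Finset.prod_univ_sum, Fintype.piFinset_univ, Int.cast_sum, map_sum, Finset.sum_mul]

theorem sum_fin_succ_pi {α M : Type*} [Fintype α] [AddCommMonoid M] {n : ℕ}
    (g : (Fin (n + 1) → α) → M) :
    ∑ x, g x = ∑ a, ∑ y : Fin n → α, g (Matrix.vecCons a y) := by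
  rw [← (Fin.consEquiv (fun _ => α)).sum_comp, Fintype.sum_prod_type]
  rfl

theorem sum_fin_zero_pi {α M : Type*} [Fintype α] [AddCommMonoid M] (g : (Fin 0 → α) → M) :
    ∑ x, g x = g ![] := by
  rw [Fintype.sum_unique]
  congr 1

theorem sum_fin_four_pi {α M : Type*} [Fintype α] [AddCommMonoid M] (g : (Fin 4 → α) → M) :
    ∑ j, ∑ k, ∑ l, ∑ m, g ![j, k, l, m] = ∑ x, g x := by
  simp only [sum_fin_succ_pi, sum_fin_zero_pi]

theorem sum_fin_sixteen_pi {α M : Type*} [Fintype α] [AddCommMonoid M] (g : (Fin 16 → α) → M) :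
    ∑ j, ∑ k, ∑ l, ∑ m, ∑ n, ∑ p, ∑ q, ∑ r, ∑ s, ∑ t, ∑ u, ∑ v, ∑ w, ∑ x, ∑ y, ∑ z,
      g ![j, k, l, m, n, p, q, r, s, t, u, v, w, x, y, z] = ∑ x, g x := by
  symm
  iterate 16 (rw [sum_fin_succ_pi]; refine Finset.sum_congr rfl fun _ _ => ?_)
  exact sum_fin_zero_pi _

/-! ### The 42 polynomials as contractions of signed pairings -/

theorem quadraticContraction_eq (b : Fin 4 → Bool) :
    quadraticContraction (chargeMatrix (b 0)) (chargeMatrix (b 1)) (chargeMatrix (b 2))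
        (chargeMatrix (b 3)) =
      ∑ g : Fin 4 → Fin 4, ∑ g' : Fin 4 → Fin 4,
        C ((∏ i, charge (b i) (g i) (g' i) : ℤ) : ℂ) * (stateVar g * stateVar g') := by
  unfold quadraticContraction
  simp only [← sum_fin_four_pi]
  refine Finset.sum_congr rfl fun j _ => Finset.sum_congr rfl fun k _ =>
    Finset.sum_congr rfl fun l _ => Finset.sum_congr rfl fun m _ =>
    Finset.sum_congr rfl fun n _ => Finset.sum_congr rfl fun p _ =>
    Finset.sum_congr rfl fun q _ => Finset.sum_congr rfl fun r _ => ?_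
  congr 2
  simp only [chargeMatrix_apply, Fin.prod_univ_four]
  rw [charge_antisymm _ n, charge_antisymm _ p, charge_antisymm _ q, charge_antisymm _ r]
  push_cast
  linear_combination (charge (b 0) j n * charge (b 1) k p * charge (b 2) l q *
    charge (b 3) m r : ℂ) * Complex.I_pow_four

theorem quadraticContraction_sq (b : Fin 4 → Bool) :
    quadraticContraction (chargeMatrix (b 0)) (chargeMatrix (b 1)) (chargeMatrix (b 2))
        (chargeMatrix (b 3)) ^ 2 =
      contraction (fun i => pairTensor (charge (b i)) 0) := by
  rw [quadraticContraction_eq, sq, contraction,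
    ← sum_fin_four_pi (α := Fin 4 → Fin 4), Finset.sum_mul]
  simp only [Finset.sum_mul]
  simp only [Finset.mul_sum]
  refine Finset.sum_congr rfl fun g _ => Finset.sum_congr rfl fun g' _ =>
    Finset.sum_congr rfl fun k _ => Finset.sum_congr rfl fun k' _ => ?_
  simp [Fin.prod_univ_four, pairTensor]
  ring

/-- Position `c`, `i` holds the number of the index of copy `c` for particle `i` in a pattern,
where the indices `j, …, z` are numbered from `0` to `15`. -/
def patternIndex (a : Fin 13) : Fin 4 → Fin 4 → Fin 16 :=
  ![![![0, 1, 2, 3], ![10, 11, 6, 7], ![4, 5, 14, 15], ![12, 13, 8, 9]],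
    ![![0, 1, 2, 3], ![10, 11, 6, 7], ![4, 13, 14, 15], ![12, 5, 8, 9]],
    ![![0, 1, 2, 3], ![4, 11, 6, 15], ![10, 5, 8, 7], ![12, 13, 14, 9]],
    ![![0, 1, 2, 3], ![4, 11, 6, 15], ![12, 13, 8, 7], ![10, 5, 14, 9]],
    ![![0, 1, 2, 3], ![4, 5, 8, 9], ![10, 11, 6, 15], ![12, 13, 14, 7]],
    ![![0, 1, 2, 3], ![10, 5, 6, 9], ![4, 11, 8, 7], ![12, 13, 14, 15]],
    ![![0, 1, 2, 3], ![10, 5, 6, 9], ![4, 11, 8, 15], ![12, 13, 14, 7]],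
    ![![0, 1, 2, 3], ![10, 5, 8, 7], ![4, 11, 14, 9], ![12, 13, 6, 15]],
    ![![0, 1, 2, 3], ![4, 11, 8, 7], ![10, 5, 14, 9], ![12, 13, 6, 15]],
    ![![0, 1, 2, 3], ![4, 11, 6, 7], ![10, 13, 14, 9], ![12, 5, 8, 15]],
    ![![0, 1, 2, 3], ![10, 5, 6, 7], ![4, 11, 8, 9], ![12, 13, 14, 15]],
    ![![0, 1, 2, 3], ![4, 5, 8, 7], ![10, 11, 14, 15], ![12, 13, 6, 9]],
    ![![0, 1, 2, 3], ![4, 5, 6, 9], ![10, 11, 8, 7], ![12, 13, 14, 15]]] a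

/-- The pairing of the four copies for each particle in a pattern. -/
def patternPairing (a : Fin 13) : Fin 4 → Fin 3 :=
  ![![1, 1, 0, 0], ![1, 2, 0, 0], ![0, 1, 0, 1], ![0, 2, 0, 1], ![0, 0, 1, 2], ![1, 0, 0, 1],
    ![1, 0, 0, 2], ![1, 0, 2, 0], ![0, 1, 2, 0], ![0, 2, 0, 0], ![1, 0, 0, 0], ![0, 0, 2, 0],
    ![0, 0, 0, 1]] a

/-- The sign by which a pattern differs from the contraction of signed pairings. -/
def patternSign (a : Fin 13) : ℤ :=
  ![1, -1, -1, -1, -1, 1, -1, -1, -1, -1, -1, -1, -1] a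

theorem patternIndex_bijective (a : Fin 13) :
    Function.Bijective (fun e : Fin 4 × Fin 4 => patternIndex a e.1 e.2) := by
  have h : ∀ a, Function.Injective (fun e : Fin 4 × Fin 4 => patternIndex a e.1 e.2) := by
    decide +kernel
  exact (Fintype.bijective_iff_injective_and_card _).2 ⟨h a, rfl⟩

/-- Every one of the sixteen letters sits at exactly one position of a pattern, so summing over the
letters is summing over all configurations. -/
theorem sum_config_eq {M : Type*} [AddCommMonoid M] (a : Fin 13) (g : Config → M) :
    ∑ x : Fin 16 → Fin 4, g (fun c i => x (patternIndex a c i)) = ∑ h, g h := by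
  let e : Fin 4 × Fin 4 ≃ Fin 16 := Equiv.ofBijective _ (patternIndex_bijective a)
  rw [← (Equiv.curry (Fin 4) (Fin 4) (Fin 4)).sum_comp,
    ← (e.symm.arrowCongr (Equiv.refl (Fin 4))).sum_comp]
  rfl

theorem quarticContraction_term (b : Bool) (a : Fin 13) (x : Fin 16 → Fin 4) :
    C (chargeMatrix b (x 4) (x 0) * chargeMatrix b (x 5) (x 1) * chargeMatrix b (x 6) (x 2) *
        chargeMatrix b (x 7) (x 3) * (chargeMatrix b (x 10) (x 12) *
        chargeMatrix b (x 11) (x 13) * chargeMatrix b (x 8) (x 14) *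
        chargeMatrix b (x 9) (x 15))) *
      indexPattern a (x 0) (x 1) (x 2) (x 3) (x 4) (x 5) (x 6) (x 7) (x 8) (x 9) (x 10) (x 11)
        (x 12) (x 13) (x 14) (x 15) =
    C (patternSign a : ℂ) *
      (C ((∏ i, pairTensor (charge b) (patternPairing a i)
        (fun c => x (patternIndex a c i)) : ℤ) : ℂ) *
      ∏ c, stateVar (fun i => x (patternIndex a c i))) := by
  have hE := charge_antisymm b
  rw [← mul_assoc (C (patternSign a : ℂ)), ← C_mul]
  refine congrArg₂ _ (congrArg _ ?_) ?_
  · simp only [chargeMatrix_apply, Fin.prod_univ_four]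
    -- `X n j` lists the later letter first, the pairing tensor the index of copy 0 first; the four
    -- flips cancel.
    rw [hE (x 4), hE (x 5), hE (x 6), hE (x 7)]
    fin_cases a <;>
      simp [patternPairing, patternIndex, patternSign, pairTensor, hE (x 12) (x 10),
        hE (x 14) (x 8), hE (x 15) (x 9)] <;>
      -- The eight factors i are removed by i⁸ - 1 = (i⁴ + 1)(i⁴ - 1).
      linear_combination (charge b (x 0) (x 4) * charge b (x 1) (x 5) * charge b (x 2) (x 6) *
        charge b (x 3) (x 7) * charge b (x 10) (x 12) * charge b (x 11) (x 13) *
        charge b (x 8) (x 14) * charge b (x 9) (x 15) : ℂ) * (Complex.I ^ 4 + 1) *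
        Complex.I_pow_four
  · fin_cases a <;> simp [Fin.prod_univ_four, stateVar, indexPattern, patternIndex]

theorem quarticContraction_eq (b : Bool) (a : Fin 13) :
    quarticContraction (chargeMatrix b) a =
      C (patternSign a : ℂ) *
        contraction (fun i => pairTensor (charge b) (patternPairing a i)) := by
  rw [contraction, Finset.mul_sum, ← sum_config_eq a]
  refine Eq.trans ?_ (Finset.sum_congr rfl fun x _ => quarticContraction_term b a x)
  rw [← sum_fin_sixteen_pi]
  unfold quarticContraction
  iterate 16 refine Finset.sum_congr rfl fun _ _ => ?_
  simp only [Matrix.cons_val]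

/-! ### Coefficients at monomials with four distinct factors -/

/-- The monomial that is the product of the state coefficients with indices `f c`. -/
def configExponent (f : Config) : Fin 4 × Fin 4 × Fin 4 × Fin 4 →₀ ℕ :=
  ∑ c, Finsupp.single (f c 0, f c 1, f c 2, f c 3) 1

theorem prod_stateVar (f : Config) :
    ∏ c, stateVar (f c) = monomial (configExponent f) (1 : ℂ) := by
  rw [configExponent, monomial_sum_one]
  rfl

/-- Equal exponents mean equal multisets of factors. As those of `f` are distinct, so are those of
`h`, and matching them defines the permutation. -/
theorem configExponent_eq_iff {f : Config} (hf : Function.Injective f) (h : Config) :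
    configExponent h = configExponent f ↔ ∃ σ : Equiv.Perm (Fin 4), f ∘ σ = h := by
  let u (g : Fin 4 → Fin 4) : Fin 4 × Fin 4 × Fin 4 × Fin 4 := (g 0, g 1, g 2, g 3)
  have hu : Function.Injective u := by
    intro g g' hg
    simp only [u, Prod.mk.injEq] at hg
    ext i
    fin_cases i <;> simp [hg]
  have key (f : Config) :
      Finsupp.toMultiset (configExponent f) = Finset.univ.val.map (u ∘ f) := by
    simp only [configExponent, map_sum, Finsupp.toMultiset_single, one_smul]
    rw [← Multiset.sum_map_singleton (Multiset.map _ _), Multiset.map_map]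
    rfl
  constructor
  · intro he
    replace he := congrArg Finsupp.toMultiset he
    rw [key, key] at he
    have hinj : Function.Injective (u ∘ h) := by
      rw [← Fintype.nodup_map_univ_iff_injective, he, Fintype.nodup_map_univ_iff_injective]
      exact hu.comp hf
    have hmem (c : Fin 4) : ∃ d, f d = h c := by
      have : (u ∘ h) c ∈ Finset.univ.val.map (u ∘ f) := by
        rw [← he]
        exact Multiset.mem_map_of_mem _ (Finset.mem_univ_val c)
      obtain ⟨d, -, hd⟩ := Multiset.mem_map.1 this
      exact ⟨d, hu hd⟩
    choose σ hσ using hmem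
    have hσi : Function.Injective σ := fun c d hcd =>
      hinj (congrArg u (by rw [← hσ c, ← hσ d, hcd]))
    exact ⟨Equiv.ofBijective σ (Finite.injective_iff_bijective.1 hσi), funext hσ⟩
  · rintro ⟨σ, rfl⟩
    exact Equiv.sum_comp σ fun c => Finsupp.single (f c 0, f c 1, f c 2, f c 3) 1

/-- The configurations with this monomial are the `f ∘ σ`, and these are pairwise distinct because
`f` is injective. -/
theorem coeff_contraction (A : Fin 4 → (Fin 4 → Fin 4) → ℤ) (f : Config)
    (hf : Function.Injective f) :
    coeff (configExponent f) (contraction A) =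
      ((∑ σ : Equiv.Perm (Fin 4), ∏ i, A i (fun c => f (σ c) i) : ℤ) : ℂ) := by
  simp only [contraction, prod_stateVar, coeff_sum, coeff_C_mul, coeff_monomial, mul_ite, mul_one,
    mul_zero, configExponent_eq_iff hf]
  rw [← Finset.sum_filter, Int.cast_sum]
  have himage : Finset.univ.filter (fun h : Config => ∃ σ : Equiv.Perm (Fin 4), f ∘ σ = h) =
      Finset.univ.image fun σ : Equiv.Perm (Fin 4) => f ∘ σ := by
    ext h
    simp only [Finset.mem_filter, Finset.mem_image, Finset.mem_univ, true_and]
  have hinj : Function.Injective fun σ : Equiv.Perm (Fin 4) => f ∘ σ :=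
    fun σ τ h => Equiv.coe_fn_injective (hf.comp_left h)
  rw [himage, Finset.sum_image hinj.injOn]
  simp only [Function.comp_apply]

/-! ### Symmetry of the pairings and the linear relation -/

/-- The contraction with the matrix `charge b` in which the four copies are paired according to
`π i` for particle `i`. -/
def pairContraction (b : Bool) (π : Fin 4 → Fin 3) : StatePoly :=
  contraction (fun i => pairTensor (charge b) (π i))

/-- Renaming the copies leaves a contraction unchanged, and the minus sign enters once for each of
the four particles, hence cancels. -/
theorem pairContraction_comp_of_pairTensor (b : Bool) (σ : Equiv.Perm (Fin 4))
    (ρ : Equiv.Perm (Fin 3))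
    (h : ∀ a g, pairTensor (charge b) a (g ∘ σ) = -pairTensor (charge b) (ρ a) g)
    (π : Fin 4 → Fin 3) : pairContraction b (ρ ∘ π) = pairContraction b π := by
  rw [pairContraction, pairContraction,
    ← contraction_comp_perm (fun i => pairTensor (charge b) (π i)) σ]
  simp only [h, contraction, Fin.prod_univ_four, mul_neg, neg_mul, neg_neg,
    Function.comp_apply]

theorem pairContraction_swap_one_two (b : Bool) (π : Fin 4 → Fin 3) :
    pairContraction b (Equiv.swap 1 2 ∘ π) = pairContraction b π := by
  refine pairContraction_comp_of_pairTensor b (Equiv.swap 0 1) _ (fun a g => ?_) π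
  have h2 : Equiv.swap (0 : Fin 4) 1 2 = 2 := by decide
  have h3 : Equiv.swap (0 : Fin 4) 1 3 = 3 := by decide
  have h0 : Equiv.swap (1 : Fin 3) 2 0 = 0 := by decide
  fin_cases a <;> simp [pairTensor, h0, h2, h3, charge_antisymm b (g 1) (g 0)] <;> ring

theorem pairContraction_swap_zero_one (b : Bool) (π : Fin 4 → Fin 3) :
    pairContraction b (Equiv.swap 0 1 ∘ π) = pairContraction b π := by
  refine pairContraction_comp_of_pairTensor b (Equiv.swap 1 2) _ (fun a g => ?_) π
  have h0 : Equiv.swap (1 : Fin 4) 2 0 = 0 := by decide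
  have h3 : Equiv.swap (1 : Fin 4) 2 3 = 3 := by decide
  have h2 : Equiv.swap (0 : Fin 3) 1 2 = 2 := by decide
  fin_cases a <;> simp [pairTensor, h0, h2, h3, charge_antisymm b (g 2) (g 1)]

theorem pairContraction_comp (b : Bool) (ρ : Equiv.Perm (Fin 3)) (π : Fin 4 → Fin 3) :
    pairContraction b (ρ ∘ π) = pairContraction b π := by
  have hρ : ∀ ρ : Equiv.Perm (Fin 3), ρ = 1 ∨ ρ = Equiv.swap 1 2 ∨ ρ = Equiv.swap 0 1 ∨
      ρ = Equiv.swap 1 2 * Equiv.swap 0 1 ∨ ρ = Equiv.swap 0 1 * Equiv.swap 1 2 ∨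
      ρ = Equiv.swap 1 2 * (Equiv.swap 0 1 * Equiv.swap 1 2) := by decide
  rcases hρ ρ with rfl | rfl | rfl | rfl | rfl | rfl <;>
    simp only [Equiv.Perm.coe_mul, Equiv.Perm.coe_one, Function.comp_assoc, Function.id_comp,
      pairContraction_swap_one_two, pairContraction_swap_zero_one]

/-- Orbit count 81 = 6 · 13 + 3: a permutation of three pairings that fixes two of them is the
identity, so the action on non-constant choices is free. -/
theorem sum_pairContraction (b : Bool) :
    ∑ π, pairContraction b π =
      6 * ∑ a, pairContraction b (patternPairing a) + 3 * pairContraction b 0 := by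
  let e : (Equiv.Perm (Fin 3) × Fin 13) ⊕ Fin 3 → Fin 4 → Fin 3 :=
    Sum.elim (fun x => x.1 ∘ patternPairing x.2) (fun c _ => c)
  have hinj : Function.Injective e := by decide +kernel
  have he : Function.Bijective e := (Fintype.bijective_iff_injective_and_card e).2 ⟨hinj, rfl⟩
  have hconst (c : Fin 3) : pairContraction b (fun _ => c) = pairContraction b 0 := by
    rw [← pairContraction_comp b (Equiv.swap 0 c) 0]
    congr 1
  rw [← he.sum_comp, Fintype.sum_sum_type, Fintype.sum_prod_type]
  simp only [e, Sum.elim_inl, Sum.elim_inr, pairContraction_comp, hconst, Finset.sum_const,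
    Finset.card_univ, Fintype.card_fin, Fintype.card_perm, nsmul_eq_mul]
  norm_num [Nat.factorial]

/-- The two Pfaffians are opposite, and the sign is raised to the fourth power. -/
theorem sum_pairContraction_charge :
    ∑ π, pairContraction false π = ∑ π, pairContraction true π := by
  have h : ∀ g : Fin 4 → Fin 4, ∑ a, pairTensor (charge false) a g =
      -∑ a, pairTensor (charge true) a g := by decide +kernel
  unfold pairContraction
  rw [← contraction_sum fun _ => pairTensor (charge false),
    ← contraction_sum fun _ => pairTensor (charge true)]
  simp only [h, contraction, Fin.prod_univ_four, mul_neg, neg_mul, neg_neg]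

theorem H_zero_sq : H 0 ^ 2 = pairContraction false 0 :=
  quadraticContraction_sq fun _ => false

theorem H_one_sq : H 1 ^ 2 = pairContraction true 0 :=
  quadraticContraction_sq fun _ => true

theorem T_eq (a : Fin 13) :
    T a = C (patternSign a : ℂ) * pairContraction false (patternPairing a) :=
  quarticContraction_eq false a

theorem Y_eq (a : Fin 13) :
    Y a = C (patternSign a : ℂ) * pairContraction true (patternPairing a) :=
  quarticContraction_eq true a

theorem H_one_sq_sub_H_zero_sq :
    H 1 ^ 2 - H 0 ^ 2 =
      2 * (T 0 - T 1 - T 2 - T 3 - T 4 + T 5 - T 6 - T 7 - T 8 - T 9 - T 10 - T 11 - T 12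
        - Y 0 + Y 1 + Y 2 + Y 3 + Y 4 - Y 5 + Y 6 + Y 7 + Y 8 + Y 9 + Y 10 + Y 11 + Y 12) := by
  have h := sum_pairContraction_charge
  rw [sum_pairContraction, sum_pairContraction, ← H_zero_sq, ← H_one_sq] at h
  simp only [T_eq, Y_eq]
  simp only [Fin.sum_univ_succ, Fin.sum_univ_zero] at h
  simp [patternSign] at h ⊢
  -- The orbit sums carry weights 6 and 3, three times those of the claim.
  refine mul_left_cancel₀ (by norm_num : (3 : StatePoly) ≠ 0) ?_
  linear_combination -h

/-! ### Uniqueness of the relation by two-term comparisons -/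

/-- The choice between `C` and `C⁵` for each particle in the polynomials `H_a, …, H_p`. -/
def hType (i : Fin 16) : Fin 4 → Bool :=
  ![![false, false, false, false], ![true, true, true, true], ![false, false, false, true],
    ![false, false, true, false], ![true, false, false, false], ![false, true, false, false],
    ![false, false, true, true], ![true, false, false, true], ![false, true, false, true],
    ![true, false, true, false], ![false, true, true, false], ![true, true, false, false],
    ![true, true, true, false], ![true, true, false, true], ![false, true, true, true],
    ![true, false, true, true]] i

theorem H_sq (i : Fin 16) :
    H i ^ 2 = contraction (fun s => pairTensor (charge (hType i s)) 0) := by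
  rw [← quadraticContraction_sq]
  fin_cases i <;> rfl

/-- The `42` polynomials. -/
def quarticFamily : Fin 16 ⊕ Fin 13 ⊕ Fin 13 → StatePoly :=
  Sum.elim (fun i => H i ^ 2) (Sum.elim T Y)

/-- Multiplication of integers that does not evaluate the second factor if the first is zero. -/
def lazyMul (x y : ℤ) : ℤ := if x = 0 then 0 else x * y

theorem lazyMul_eq (x y : ℤ) : lazyMul x y = x * y := by
  unfold lazyMul
  split_ifs with h <;> simp [h]

/-- The permutations of `Fin 4` as a list of functions. -/
def permList : List (Fin 4 → Fin 4) :=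
  [![0, 1, 2, 3], ![0, 1, 3, 2], ![0, 2, 1, 3], ![0, 2, 3, 1], ![0, 3, 1, 2], ![0, 3, 2, 1],
    ![1, 0, 2, 3], ![1, 0, 3, 2], ![1, 2, 0, 3], ![1, 2, 3, 0], ![1, 3, 0, 2], ![1, 3, 2, 0],
    ![2, 0, 1, 3], ![2, 0, 3, 1], ![2, 1, 0, 3], ![2, 1, 3, 0], ![2, 3, 0, 1], ![2, 3, 1, 0],
    ![3, 0, 1, 2], ![3, 0, 2, 1], ![3, 1, 0, 2], ![3, 1, 2, 0], ![3, 2, 0, 1], ![3, 2, 1, 0]]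

/-- Allows the kernel to evaluate coefficients over an explicit list instead of enumerating
`Equiv.Perm (Fin 4)` each time. -/
theorem map_coe_univ_perm :
    (Finset.univ : Finset (Equiv.Perm (Fin 4))).val.map (fun σ => (σ : Fin 4 → Fin 4)) =
      (permList : Multiset (Fin 4 → Fin 4)) := by
  decide +kernel

/-- The coefficient of the contraction with tensors `A` at the monomial of `f`, in a form that is
fast to evaluate. -/
def configCoeff (f : Config) (A : Fin 4 → (Fin 4 → Fin 4) → ℤ) : ℤ :=
  (permList.map fun σ =>
    lazyMul (A 0 fun c => f (σ c) 0) (lazyMul (A 1 fun c => f (σ c) 1)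
      (lazyMul (A 2 fun c => f (σ c) 2) (A 3 fun c => f (σ c) 3)))).sum

theorem configCoeff_eq (f : Config) (A : Fin 4 → (Fin 4 → Fin 4) → ℤ) :
    configCoeff f A = ∑ σ : Equiv.Perm (Fin 4), ∏ i, A i (fun c => f (σ c) i) := by
  have h := congrArg (fun s => (s.map fun σ => ∏ i, A i fun c => f (σ c) i).sum) map_coe_univ_perm
  simp only [Multiset.map_map, Multiset.map_coe, Multiset.sum_coe] at h
  refine Eq.trans ?_ h.symm
  simp only [configCoeff, lazyMul_eq, Fin.prod_univ_four, mul_assoc]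

/-- The coefficients of the `42` polynomials at the monomial of `f`. -/
def familyCoeff (f : Config) : Fin 16 ⊕ Fin 13 ⊕ Fin 13 → ℤ
  | .inl i => configCoeff f fun s => pairTensor (charge (hType i s)) 0
  | .inr (.inl a) =>
    patternSign a * configCoeff f fun s => pairTensor (charge false) (patternPairing a s)
  | .inr (.inr a) =>
    patternSign a * configCoeff f fun s => pairTensor (charge true) (patternPairing a s)

theorem coeff_quarticFamily {f : Config} (hf : Function.Injective f)
    (k : Fin 16 ⊕ Fin 13 ⊕ Fin 13) :
    coeff (configExponent f) (quarticFamily k) = (familyCoeff f k : ℂ) := by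
  rcases k with i | a | a
  · exact (congrArg _ (H_sq i)).trans <| by
      rw [coeff_contraction _ f hf, ← configCoeff_eq, familyCoeff]
  · refine (congrArg _ (T_eq a)).trans ?_
    rw [coeff_C_mul, pairContraction, coeff_contraction _ f hf, ← configCoeff_eq, familyCoeff,
      Int.cast_mul]
  · refine (congrArg _ (Y_eq a)).trans ?_
    rw [coeff_C_mul, pairContraction, coeff_contraction _ f hf, ← configCoeff_eq, familyCoeff,
      Int.cast_mul]

/-- A monomial that occurs in at most two of the `42` polynomials gives a relation between two
coefficients of a vanishing linear combination. -/
theorem two_term_relation {γ : Fin 16 ⊕ Fin 13 ⊕ Fin 13 → ℂ}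
    (hγ : ∑ k, γ k • quarticFamily k = 0) (f : Config) (k₁ k₂ : Fin 16 ⊕ Fin 13 ⊕ Fin 13)
    (r₁ r₂ : ℤ) (hf : Function.Injective f)
    (hr : k₁ ≠ k₂ ∧ ∀ k, familyCoeff f k = if k = k₁ then r₁ else if k = k₂ then r₂ else 0) :
    r₁ * γ k₁ + r₂ * γ k₂ = 0 := by
  have h := congrArg (coeff (configExponent f)) hγ
  simp only [coeff_sum, coeff_smul, coeff_quarticFamily hf, coeff_zero, smul_eq_mul] at h
  rw [Fintype.sum_eq_add k₁ k₂ hr.1 fun k hk => by simp [hr.2, hk.1, hk.2], hr.2, hr.2, if_pos rfl,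
    if_neg hr.1.symm, if_pos rfl] at h
  linear_combination h

/-- Coefficients of squares are multiples of 8, the number of copy permutations preserving a
pairing; those of T and Y are multiples of 4, the order of the Klein group preserving all three. Any
injective configuration with the checked coefficients would serve as a witness. -/
theorem coefficients_H {γ : Fin 16 ⊕ Fin 13 ⊕ Fin 13 → ℂ}
    (hγ : ∑ k, γ k • quarticFamily k = 0) :
    (fun i => γ (.inl i)) = γ (.inl 1) • ![-1, 1, 0, 0, 0, 0, 0, 0, 0, 0, 0, 0, 0, 0, 0, 0] := by
  have h2 : γ (.inl 2) = 0 := by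
    -- The second term `.inl 1` has coefficient 0 and is a filler: only one of the 42 polynomials
    -- contains this monomial. The same holds up to `h15`.
    linear_combination (-1 / 8 : ℂ) * two_term_relation hγ
      ![![1, 2, 2, 3], ![0, 3, 3, 0], ![2, 1, 1, 3], ![3, 0, 0, 0]]
      (.inl 2) (.inl 1) (-8) 0 (by decide) (by decide +kernel)
  have h3 : γ (.inl 3) = 0 := by
    linear_combination (1 / 8 : ℂ) * two_term_relation hγ
      ![![2, 3, 1, 0], ![3, 2, 2, 1], ![1, 3, 2, 2], ![0, 2, 1, 3]]
      (.inl 3) (.inl 1) 8 0 (by decide) (by decide +kernel)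
  have h4 : γ (.inl 4) = 0 := by
    linear_combination (-1 / 8 : ℂ) * two_term_relation hγ
      ![![3, 2, 1, 3], ![3, 0, 0, 1], ![0, 1, 1, 0], ![0, 3, 0, 2]]
      (.inl 4) (.inl 1) (-8) 0 (by decide) (by decide +kernel)
  have h5 : γ (.inl 5) = 0 := by
    linear_combination (-1 / 8 : ℂ) * two_term_relation hγ
      ![![1, 3, 1, 0], ![3, 0, 3, 2], ![2, 3, 2, 3], ![0, 0, 0, 1]]
      (.inl 5) (.inl 1) (-8) 0 (by decide) (by decide +kernel)
  have h6 : γ (.inl 6) = 0 := by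
    linear_combination (-1 / 8 : ℂ) * two_term_relation hγ
      ![![3, 2, 2, 1], ![2, 1, 1, 3], ![3, 0, 2, 0], ![2, 3, 1, 2]]
      (.inl 6) (.inl 1) (-8) 0 (by decide) (by decide +kernel)
  have h7 : γ (.inl 7) = 0 := by
    linear_combination (-1 / 8 : ℂ) * two_term_relation hγ
      ![![0, 2, 1, 0], ![1, 1, 0, 0], ![2, 0, 1, 3], ![3, 3, 0, 3]]
      (.inl 7) (.inl 1) (-8) 0 (by decide) (by decide +kernel)
  have h8 : γ (.inl 8) = 0 := by
    linear_combination (1 / 8 : ℂ) * two_term_relation hγ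
      ![![3, 3, 2, 1], ![1, 2, 3, 1], ![2, 0, 3, 2], ![0, 1, 2, 2]]
      (.inl 8) (.inl 1) 8 0 (by decide) (by decide +kernel)
  have h9 : γ (.inl 9) = 0 := by
    linear_combination (-1 / 8 : ℂ) * two_term_relation hγ
      ![![1, 1, 1, 3], ![3, 0, 2, 0], ![0, 1, 1, 1], ![2, 0, 2, 2]]
      (.inl 9) (.inl 1) (-8) 0 (by decide) (by decide +kernel)
  have h10 : γ (.inl 10) = 0 := by
    linear_combination (-1 / 8 : ℂ) * two_term_relation hγ
      ![![3, 0, 3, 1], ![3, 3, 2, 0], ![2, 0, 1, 1], ![2, 3, 0, 0]]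
      (.inl 10) (.inl 1) (-8) 0 (by decide) (by decide +kernel)
  have h11 : γ (.inl 11) = 0 := by
    linear_combination (1 / 8 : ℂ) * two_term_relation hγ
      ![![3, 2, 3, 2], ![1, 1, 3, 1], ![2, 2, 2, 0], ![0, 1, 2, 3]]
      (.inl 11) (.inl 1) 8 0 (by decide) (by decide +kernel)
  have h12 : γ (.inl 12) = 0 := by
    linear_combination (1 / 8 : ℂ) * two_term_relation hγ
      ![![3, 0, 2, 0], ![1, 1, 1, 0], ![2, 2, 2, 1], ![0, 3, 1, 1]]
      (.inl 12) (.inl 1) 8 0 (by decide) (by decide +kernel)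
  have h13 : γ (.inl 13) = 0 := by
    linear_combination (1 / 8 : ℂ) * two_term_relation hγ
      ![![3, 0, 1, 0], ![2, 2, 1, 3], ![0, 3, 0, 3], ![1, 1, 0, 0]]
      (.inl 13) (.inl 1) 8 0 (by decide) (by decide +kernel)
  have h14 : γ (.inl 14) = 0 := by
    linear_combination (-1 / 8 : ℂ) * two_term_relation hγ
      ![![0, 0, 2, 0], ![0, 0, 0, 3], ![1, 3, 1, 3], ![1, 3, 3, 0]]
      (.inl 14) (.inl 1) (-8) 0 (by decide) (by decide +kernel)
  have h15 : γ (.inl 15) = 0 := by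
    linear_combination (1 / 8 : ℂ) * two_term_relation hγ
      ![![1, 1, 0, 1], ![1, 0, 3, 1], ![2, 1, 0, 2], ![2, 0, 3, 2]]
      (.inl 15) (.inl 1) 8 0 (by decide) (by decide +kernel)
  have h0 : γ (.inl 0) = -1 * γ (.inl 1) := by
    linear_combination (1 / 8 : ℂ) * two_term_relation hγ
      ![![2, 3, 3, 1], ![1, 0, 0, 2], ![3, 2, 2, 0], ![0, 1, 1, 3]]
      (.inl 0) (.inl 1) 8 8 (by decide) (by decide +kernel)
  ext i
  fin_cases i <;> simp [*]

theorem coefficients_T {γ : Fin 16 ⊕ Fin 13 ⊕ Fin 13 → ℂ}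
    (hγ : ∑ k, γ k • quarticFamily k = 0) :
    (fun i => γ (.inr (.inl i))) = γ (.inl 1) • ![-2, 2, 2, 2, 2, -2, 2, 2, 2, 2, 2, 2, 2] := by
  have h0 : γ (.inr (.inl 0)) = -2 * γ (.inl 1) := by
    linear_combination (1 / 4 : ℂ) * two_term_relation hγ
      ![![2, 0, 0, 0], ![0, 2, 1, 1], ![1, 3, 3, 3], ![3, 1, 2, 2]]
      (.inr (.inl 0)) (.inl 1) 4 8 (by decide) (by decide +kernel)
  have h2 : γ (.inr (.inl 2)) = 2 * γ (.inl 1) := by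
    linear_combination (-1 / 4 : ℂ) * two_term_relation hγ
      ![![1, 3, 0, 3], ![3, 2, 2, 2], ![0, 1, 1, 1], ![2, 0, 3, 0]]
      (.inr (.inl 2)) (.inl 1) (-4) 8 (by decide) (by decide +kernel)
  have h5 : γ (.inr (.inl 5)) = -2 * γ (.inl 1) := by
    linear_combination (1 / 4 : ℂ) * two_term_relation hγ
      ![![2, 2, 2, 3], ![1, 1, 1, 0], ![3, 0, 0, 2], ![0, 3, 3, 1]]
      (.inr (.inl 5)) (.inl 1) 4 8 (by decide) (by decide +kernel)
  have h9 : γ (.inr (.inl 9)) = 2 * γ (.inl 1) := by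
    linear_combination (1 / 4 : ℂ) * two_term_relation hγ
      ![![0, 0, 3, 2], ![2, 1, 1, 0], ![1, 2, 2, 3], ![3, 3, 0, 1]]
      (.inr (.inl 9)) (.inl 1) 4 (-8) (by decide) (by decide +kernel)
  have h10 : γ (.inr (.inl 10)) = 2 * γ (.inl 1) := by
    linear_combination (1 / 4 : ℂ) * two_term_relation hγ
      ![![3, 0, 1, 3], ![2, 2, 3, 1], ![0, 3, 2, 0], ![1, 1, 0, 2]]
      (.inr (.inl 10)) (.inl 1) 4 (-8) (by decide) (by decide +kernel)
  have h11 : γ (.inr (.inl 11)) = 2 * γ (.inl 1) := by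
    linear_combination (1 / 4 : ℂ) * two_term_relation hγ
      ![![1, 0, 3, 0], ![2, 3, 0, 3], ![3, 2, 2, 2], ![0, 1, 1, 1]]
      (.inr (.inl 11)) (.inl 1) 4 (-8) (by decide) (by decide +kernel)
  have h12 : γ (.inr (.inl 12)) = 2 * γ (.inl 1) := by
    linear_combination (1 / 4 : ℂ) * two_term_relation hγ
      ![![0, 3, 3, 1], ![3, 0, 0, 2], ![1, 2, 2, 3], ![2, 1, 1, 0]]
      (.inr (.inl 12)) (.inl 1) 4 (-8) (by decide) (by decide +kernel)
  -- From here on the monomials link to `T 0`, `T 2` or `T 5`, whose coefficients are already known,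
  -- instead of to `H 1 ^ 2`.
  have h1 : γ (.inr (.inl 1)) = 2 * γ (.inl 1) := by
    linear_combination (-1 / 4 : ℂ) * two_term_relation hγ
      ![![3, 1, 3, 1], ![3, 2, 2, 0], ![2, 0, 1, 3], ![2, 3, 0, 2]]
      (.inr (.inl 1)) (.inr (.inl 0)) (-4) (-4) (by decide) (by decide +kernel) - h0
  have h4 : γ (.inr (.inl 4)) = 2 * γ (.inl 1) := by
    linear_combination (1 / 4 : ℂ) * two_term_relation hγ
      ![![1, 3, 0, 1], ![3, 0, 0, 0], ![2, 1, 1, 0], ![0, 2, 1, 1]]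
      (.inr (.inl 4)) (.inr (.inl 0)) 4 4 (by decide) (by decide +kernel) - h0
  have h3 : γ (.inr (.inl 3)) = 2 * γ (.inl 1) := by
    linear_combination (-1 / 4 : ℂ) * two_term_relation hγ
      ![![1, 3, 3, 3], ![0, 3, 2, 1], ![2, 2, 1, 0], ![3, 2, 0, 2]]
      (.inr (.inl 3)) (.inr (.inl 2)) (-4) 4 (by decide) (by decide +kernel) + h2
  have h7 : γ (.inr (.inl 7)) = 2 * γ (.inl 1) := by
    linear_combination (-1 / 4 : ℂ) * two_term_relation hγ
      ![![0, 2, 1, 0], ![1, 0, 0, 3], ![2, 3, 1, 1], ![3, 1, 0, 2]]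
      (.inr (.inl 7)) (.inr (.inl 2)) (-4) 4 (by decide) (by decide +kernel) + h2
  have h6 : γ (.inr (.inl 6)) = 2 * γ (.inl 1) := by
    linear_combination (-1 / 4 : ℂ) * two_term_relation hγ
      ![![2, 1, 1, 2], ![3, 3, 3, 3], ![1, 0, 0, 2], ![0, 2, 2, 3]]
      (.inr (.inl 6)) (.inr (.inl 5)) (-4) (-4) (by decide) (by decide +kernel) - h5
  have h8 : γ (.inr (.inl 8)) = 2 * γ (.inl 1) := by
    linear_combination (1 / 4 : ℂ) * two_term_relation hγ
      ![![1, 1, 2, 1], ![2, 0, 2, 3], ![3, 0, 3, 2], ![0, 1, 3, 0]]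
      (.inr (.inl 8)) (.inr (.inl 5)) 4 4 (by decide) (by decide +kernel) - h5
  ext i
  fin_cases i <;> simp [*] <;> ring

theorem coefficients_Y {γ : Fin 16 ⊕ Fin 13 ⊕ Fin 13 → ℂ}
    (hγ : ∑ k, γ k • quarticFamily k = 0) :
    (fun i => γ (.inr (.inr i))) =
      γ (.inl 1) • ![2, -2, -2, -2, -2, 2, -2, -2, -2, -2, -2, -2, -2] := by
  have hα0 : γ (.inl 0) = -1 * γ (.inl 1) := by
    simpa [mul_comm] using congrFun (coefficients_H hγ) 0
  have hτ0 : γ (.inr (.inl 0)) = -2 * γ (.inl 1) := by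
    simpa [mul_comm] using congrFun (coefficients_T hγ) 0
  have hτ2 : γ (.inr (.inl 2)) = 2 * γ (.inl 1) := by
    simpa [mul_comm] using congrFun (coefficients_T hγ) 2
  have h9 : γ (.inr (.inr 9)) = -2 * γ (.inl 1) := by
    linear_combination (-1 / 4 : ℂ) * two_term_relation hγ
      ![![1, 3, 2, 0], ![2, 0, 1, 3], ![3, 3, 3, 2], ![0, 0, 0, 1]]
      (.inr (.inr 9)) (.inl 1) (-4) (-8) (by decide) (by decide +kernel)
  have h10 : γ (.inr (.inr 10)) = -2 * γ (.inl 1) := by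
    linear_combination (1 / 4 : ℂ) * two_term_relation hγ
      ![![1, 1, 1, 0], ![2, 2, 2, 3], ![2, 3, 0, 2], ![1, 0, 3, 1]]
      (.inr (.inr 10)) (.inl 1) 4 8 (by decide) (by decide +kernel)
  have h11 : γ (.inr (.inr 11)) = -2 * γ (.inl 1) := by
    linear_combination (1 / 4 : ℂ) * two_term_relation hγ
      ![![1, 0, 2, 2], ![2, 3, 1, 1], ![3, 1, 2, 3], ![0, 2, 1, 0]]
      (.inr (.inr 11)) (.inl 1) 4 8 (by decide) (by decide +kernel)
  have h12 : γ (.inr (.inr 12)) = -2 * γ (.inl 1) := by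
    linear_combination (-1 / 4 : ℂ) * two_term_relation hγ
      ![![0, 2, 2, 0], ![1, 3, 3, 0], ![2, 0, 0, 3], ![3, 1, 1, 3]]
      (.inr (.inr 12)) (.inl 1) (-4) (-8) (by decide) (by decide +kernel)
  have h0 : γ (.inr (.inr 0)) = 2 * γ (.inl 1) := by
    linear_combination (1 / 4 : ℂ) * two_term_relation hγ
      ![![1, 1, 1, 2], ![2, 2, 3, 0], ![3, 3, 2, 1], ![0, 0, 0, 3]]
      (.inr (.inr 0)) (.inl 0) 4 8 (by decide) (by decide +kernel) - 2 * hα0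
  have h2 : γ (.inr (.inr 2)) = -2 * γ (.inl 1) := by
    linear_combination (-1 / 4 : ℂ) * two_term_relation hγ
      ![![2, 3, 3, 2], ![3, 2, 2, 3], ![1, 1, 0, 0], ![0, 0, 1, 1]]
      (.inr (.inr 2)) (.inl 0) (-4) 8 (by decide) (by decide +kernel) + 2 * hα0
  have h5 : γ (.inr (.inr 5)) = 2 * γ (.inl 1) := by
    linear_combination (1 / 4 : ℂ) * two_term_relation hγ
      ![![1, 0, 0, 1], ![0, 1, 1, 0], ![2, 2, 2, 2], ![3, 3, 3, 3]]
      (.inr (.inr 5)) (.inl 0) 4 8 (by decide) (by decide +kernel) - 2 * hα0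
  have h3 : γ (.inr (.inr 3)) = -2 * γ (.inl 1) := by
    linear_combination (-1 / 4 : ℂ) * two_term_relation hγ
      ![![0, 2, 0, 0], ![1, 3, 2, 3], ![2, 1, 1, 1], ![3, 0, 3, 2]]
      (.inr (.inr 3)) (.inr (.inl 0)) (-4) 4 (by decide) (by decide +kernel) + hτ0
  have h6 : γ (.inr (.inr 6)) = -2 * γ (.inl 1) := by
    linear_combination (-1 / 4 : ℂ) * two_term_relation hγ
      ![![0, 0, 3, 2], ![2, 3, 0, 0], ![1, 1, 1, 1], ![3, 2, 2, 3]]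
      (.inr (.inr 6)) (.inr (.inl 0)) (-4) 4 (by decide) (by decide +kernel) + hτ0
  have h7 : γ (.inr (.inr 7)) = -2 * γ (.inl 1) := by
    linear_combination (-1 / 4 : ℂ) * two_term_relation hγ
      ![![2, 1, 1, 1], ![0, 2, 3, 2], ![3, 0, 2, 3], ![1, 3, 0, 0]]
      (.inr (.inr 7)) (.inr (.inl 0)) (-4) 4 (by decide) (by decide +kernel) + hτ0
  have h8 : γ (.inr (.inr 8)) = -2 * γ (.inl 1) := by
    linear_combination (-1 / 4 : ℂ) * two_term_relation hγ
      ![![0, 3, 3, 1], ![2, 0, 2, 0], ![1, 2, 0, 3], ![3, 1, 1, 2]]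
      (.inr (.inr 8)) (.inr (.inl 0)) (-4) 4 (by decide) (by decide +kernel) + hτ0
  have h1 : γ (.inr (.inr 1)) = -2 * γ (.inl 1) := by
    linear_combination (-1 / 4 : ℂ) * two_term_relation hγ
      ![![0, 3, 0, 3], ![1, 0, 1, 1], ![3, 2, 2, 2], ![2, 1, 3, 0]]
      (.inr (.inr 1)) (.inr (.inl 2)) (-4) (-4) (by decide) (by decide +kernel) - hτ2
  have h4 : γ (.inr (.inr 4)) = -2 * γ (.inl 1) := by
    linear_combination (-1 / 4 : ℂ) * two_term_relation hγ
      ![![1, 1, 1, 2], ![2, 2, 3, 0], ![3, 0, 2, 3], ![0, 3, 0, 1]]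
      (.inr (.inr 4)) (.inr (.inl 2)) (-4) (-4) (by decide) (by decide +kernel) - hτ2
  ext i
  fin_cases i <;> simp [*] <;> ring

theorem eq_of_sum_eq_zero {α : Fin 16 → ℂ} {τ υ : Fin 13 → ℂ}
    (h : (∑ i, α i • H i ^ 2) + (∑ i, τ i • T i) + (∑ i, υ i • Y i) = 0) :
    α = α 1 • ![-1, 1, 0, 0, 0, 0, 0, 0, 0, 0, 0, 0, 0, 0, 0, 0] ∧
      τ = α 1 • ![-2, 2, 2, 2, 2, -2, 2, 2, 2, 2, 2, 2, 2] ∧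
      υ = α 1 • ![2, -2, -2, -2, -2, 2, -2, -2, -2, -2, -2, -2, -2] := by
  have hγ : ∑ k, Sum.elim α (Sum.elim τ υ) k • quarticFamily k = 0 := by
    rw [Fintype.sum_sum_type, Fintype.sum_sum_type, ← add_assoc]
    exact h
  exact ⟨coefficients_H hγ, coefficients_T hγ, coefficients_Y hγ⟩

/-! ### Kernel and rank of the combination map -/

/-- The linear combination of the `42` polynomials with given coefficients. -/
def combination : (Fin 16 → ℂ) × (Fin 13 → ℂ) × (Fin 13 → ℂ) →ₗ[ℂ] StatePoly :=
  (Fintype.linearCombination ℂ fun i => H i ^ 2).coprod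
    ((Fintype.linearCombination ℂ T).coprod (Fintype.linearCombination ℂ Y))

theorem combination_apply (α : Fin 16 → ℂ) (τ υ : Fin 13 → ℂ) :
    combination (α, τ, υ) =
      (∑ i, α i • H i ^ 2) + (∑ i, τ i • T i) + (∑ i, υ i • Y i) := by
  simp [combination, Fintype.linearCombination_apply, add_assoc]

theorem range_combination :
    LinearMap.range combination =
      Submodule.span ℂ (Set.range (fun i : Fin 16 => H i ^ 2) ∪ Set.range T ∪ Set.range Y) := by
  rw [combination, LinearMap.range_coprod, LinearMap.range_coprod,
    Fintype.range_linearCombination, Fintype.range_linearCombination,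
    Fintype.range_linearCombination, Submodule.span_union, Submodule.span_union, sup_assoc]

/-- The coefficients of the relation between the `42` polynomials. -/
def relation : (Fin 16 → ℂ) × (Fin 13 → ℂ) × (Fin 13 → ℂ) :=
  (![-1, 1, 0, 0, 0, 0, 0, 0, 0, 0, 0, 0, 0, 0, 0, 0],
    ![-2, 2, 2, 2, 2, -2, 2, 2, 2, 2, 2, 2, 2],
    ![2, -2, -2, -2, -2, 2, -2, -2, -2, -2, -2, -2, -2])

theorem combination_relation : combination relation = 0 := by
  rw [relation, combination_apply]
  simp only [Fin.sum_univ_succ, Fin.sum_univ_zero]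
  have h := H_one_sq_sub_H_zero_sq
  have hC : (C (2 : ℂ) : StatePoly) = 2 := map_ofNat C 2
  simp [smul_eq_C_mul, hC]
  linear_combination h

theorem ker_combination : LinearMap.ker combination = Submodule.span ℂ {relation} := by
  refine le_antisymm (fun γ hγ => ?_) ?_
  · obtain ⟨α, τ, υ⟩ := γ
    rw [LinearMap.mem_ker, combination_apply] at hγ
    obtain ⟨hα, hτ, hυ⟩ := eq_of_sum_eq_zero hγ
    exact Submodule.mem_span_singleton.2
      ⟨α 1, Prod.ext hα.symm (Prod.ext hτ.symm hυ.symm)⟩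
  · rw [Submodule.span_singleton_le_iff_mem]
    exact combination_relation

theorem finrank_range_combination : Module.finrank ℂ (LinearMap.range combination) = 41 := by
  have h := combination.finrank_range_add_finrank_ker
  have hne : relation ≠ 0 := fun h0 => by
    have := congrFun (congrArg Prod.fst h0) 1
    simp [relation] at this
  rw [ker_combination, finrank_span_singleton hne] at h
  simp at h
  omega

end FourSpinors

end

open FourSpinors
theorem mainTheorem4 :
    Module.finrank ℂ
        (Submodule.span ℂ
          (Set.range (fun i : Fin 16 => H i ^ 2) ∪ Set.range T ∪ Set.range Y)) = 41 ∧
    H 1 ^ 2 - H 0 ^ 2 =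
      2 * (T 0 - T 1 - T 2 - T 3 - T 4 + T 5 - T 6 - T 7 - T 8 - T 9 - T 10 - T 11 - T 12
        - Y 0 + Y 1 + Y 2 + Y 3 + Y 4 - Y 5 + Y 6 + Y 7 + Y 8 + Y 9 + Y 10 + Y 11 + Y 12) ∧
    ∀ (α : Fin 16 → ℂ) (τ υ : Fin 13 → ℂ),
      (∑ i, α i • H i ^ 2) + (∑ i, τ i • T i) + (∑ i, υ i • Y i) = 0 ↔
        ∃ c : ℂ,
          α = c • ![-1, 1, 0, 0, 0, 0, 0, 0, 0, 0, 0, 0, 0, 0, 0, 0] ∧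
          τ = c • ![-2, 2, 2, 2, 2, -2, 2, 2, 2, 2, 2, 2, 2] ∧
          υ = c • ![2, -2, -2, -2, -2, 2, -2, -2, -2, -2, -2, -2, -2] := by
  refine ⟨?_, H_one_sq_sub_H_zero_sq, fun α τ υ => ⟨fun h => ⟨α 1, eq_of_sum_eq_zero h⟩, ?_⟩⟩
  · rw [← range_combination]
    exact finrank_range_combination
  · rintro ⟨c, rfl, rfl, rfl⟩
    rw [← combination_apply]
    exact (combination.map_smul c relation).trans (by rw [combination_relation, smul_zero])
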